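/- **Theorem (Exponent for partly smooth KL functions).** Conventions. $\mathbb{R}^n$ carries the Euclidean inner product and norm. A function $f:\mathbb{R}^n\to[-\infty,\infty]$ is *proper* if it is never $-\infty$ and $\mathrm{dom}\,f=\{x: f(x)<\infty\}\neq\emptyset$, and *closed* if it is lower semicontinuous. For $x\in\mathrm{dom}\,f$, the regular subdifferential is $$\widehat\partial f(x)=\Big\{v:\ \liminf_{z\to x,\,z\ne x}\frac{f(z)-f(x)-\langle v,z-x\rangle}{\|z-x\|}\ge 0\Big\},$$ and the limiting subdifferential $\partial f(x)$ is the set of all limits $v=\lim_t v^t$ with $v^t\in\widehat\partial f(x^t)$, $x^t\to x$, $f(x^t)\to f(x)$; both are empty when $x\notin\mathrm{dom}\,f$. For a set $S$ and $x\in S$, with $\delta_S$ the indicator function ($0$ on $S$, $+\infty$ off $S$), $N_S(x)=\partial\delta_S(x)$ and $\widehat N_S(x)=\widehat\partial\delta_S(x)$ are the limiting and regular normal cones. A function $f$ is *regular* at $x\in\mathrm{dom}\,f$ if $N_{\mathrm{epi} f}=\widehat N_{\mathrm{epi} f}$ at $(x,f(x))$. The function $f$ is *prox-regular* at $\bar x\in\mathrm{dom}\,f$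 if for every $\bar v\in\partial f(\bar x)$ there are $\rho\ge 0$ and $\delta>0$ such that $f(x')\ge f(x)+\langle v,x'-x\rangle-\frac{\rho}{2}\|x'-x\|^2$ whenever $\|x-\bar x\|<\delta$, $\|x'-\bar x\|<\delta$, $|f(x)-f(\bar x)|<\delta$, $v\in\partial f(x)$ and $\|v-\bar v\|<\delta$. A set $\mathfrak M\ni\bar x$ is a *$C^2$ manifold about $\bar x$* if on some open neighbourhood of $\bar x$ it is the solution set of finitely many $C^2$ equations $g_i(x)=0$ whose gradients $\nabla g_i(\bar x)$ are linearly independent. $T_x(\mathfrak M)$ is its tangent space at $x$, and $P_{\mathfrak M}$ the nearest-point projection onto $\mathfrak M$, which is well defined near $\bar x$. For $x\in\mathfrak M$ near $\bar x$ and $f$ whose restriction to $\mathfrak M$ is $C^2$ near $x$, the covariant derivative $\nabla_{\mathfrak M}f(x)$ is the unique vector in $T_x(\mathfrak M)$ with $\langle\nabla_{\mathfrak M}f(x),\xi\rangle=\frac{d}{dt}f(P_{\mathfrak M}(x+t\xi))\big|_{t=0}$ for all $\xi\in T_x(\mathfrak M)$. The function $f$ is *$C^2$-partly smooth at $\bar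 x$ relative to $\mathfrak M$* if $\mathfrak M$ is a $C^2$ manifold about $\bar x$ and (i) the restriction of $f$ to $\mathfrak M$ is $C^2$ near $\bar x$ (it agrees on $\mathfrak M$, near $\bar x$, with a $C^2$ function defined on a neighbourhood of $\bar x$); (ii) at every $x\in\mathfrak M$ close to $\bar x$, $f$ is regular and $\partial f(x)\ne\emptyset$; (iii) the affine span of $\partial f(\bar x)$ is a translate of $N_{\mathfrak M}(\bar x)$; (iv) the set-valued map $\partial f$ restricted to $\mathfrak M$ is continuous (inner and outer semicontinuous in the sense of Painlevé–Kuratowski) at $\bar x$. Statement. Let $f:\mathbb{R}^n\to(-\infty,\infty]$ be proper and closed, prox-regular at $\bar x$ and $C^2$-partly smooth at $\bar x$ relative to $\mathfrak M$, and suppose that $0\in\mathrm{ri}\,\partial f(\bar x)$ (the relative interior). Suppose further that there exist $c,\nu,\epsilon>0$ and $\alpha\in[0,1)$ such that for every $x\in\mathfrak M$ with $\|x-\bar x\|\le\epsilon$ and $f(\bar x)<f(x)<f(\bar x)+\nu$, the covariant derivative $\nabla_{\mathfrak M}f(x)$ exists and $$\|\nabla_{\mathfrak M}f(x)\|\ge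 c\,(f(x)-f(\bar x))^{\alpha}.$$ Then $f$ has the Kurdyka–Łojasiewicz property at $\bar x$ with exponent $\alpha$: $\partial f(\bar x)\neq\emptyset$, and there exist $c',\epsilon'>0$ and $\nu'\in(0,\infty]$ such that $$\mathrm{dist}(0,\partial f(x))\ge c'\,(f(x)-f(\bar x))^{\alpha}\quad\text{whenever } \|x-\bar x\|\le\epsilon' \text{ and } f(\bar x)<f(x)<f(\bar x)+\nu',$$ where $\mathrm{dist}(0,\emptyset)=+\infty$. -/

import Mathlib

open Set Filter Topology
open scoped InnerProductSpace

namespace VarAnalysis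

noncomputable section

variable {E : Type*} [NormedAddCommGroup E] [InnerProductSpace ℝ E]

/-- An extended-real-valued function is proper if it never takes the value `-∞` and its domain
`{x | f x < ∞}` is nonempty. -/
def IsProper (f : E → EReal) : Prop :=
  (∀ x, f x ≠ ⊥) ∧ ∃ x, f x < ⊤

/-- The regular (Fréchet) subdifferential; it is empty outside the domain of `f`. -/
def regularSubdifferential (f : E → EReal) (x : E) : Set E :=
  {v | f x < ⊤ ∧
    0 ≤ liminf (fun z => (f z - f x - ((⟪v, z - x⟫_ℝ : ℝ) : EReal)) / ((‖z - x‖ : ℝ) : EReal))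
      (𝓝[≠] x)}

/-- The limiting subdifferential; it is empty outside the domain of `f`. -/
def subdifferential (f : E → EReal) (x : E) : Set E :=
  {v | f x < ⊤ ∧ ∃ (y : ℕ → E) (w : ℕ → E),
    Tendsto y atTop (𝓝 x) ∧ Tendsto (fun t => f (y t)) atTop (𝓝 (f x)) ∧
    Tendsto w atTop (𝓝 v) ∧ ∀ t, w t ∈ regularSubdifferential f (y t)}

open Classical in
/-- The indicator function of a set: `0` on `S`, `+∞` outside. -/
def indicatorFun (S : Set E) (x : E) : EReal :=
  if x ∈ S then 0 else ⊤

/-- The regular normal cone of `S` at `x`. -/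
def regularNormalCone (S : Set E) (x : E) : Set E :=
  regularSubdifferential (indicatorFun S) x

/-- The limiting normal cone of `S` at `x`. -/
def normalCone (S : Set E) (x : E) : Set E :=
  subdifferential (indicatorFun S) x

/-- The epigraph of `f`, in the product `E × ℝ` with its Euclidean (`ℓ²`) structure. -/
def epigraph (f : E → EReal) : Set (WithLp 2 (E × ℝ)) :=
  {p | f p.fst ≤ ((p.snd : ℝ) : EReal)}

/-- `f` is (subdifferentially) regular at `x ∈ dom f`: its epigraph is regular at `(x, f x)`, that
is, the limiting and the regular normal cones of the epigraph coincide there. -/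
def IsRegularAt (f : E → EReal) (x : E) : Prop :=
  f x < ⊤ ∧
    normalCone (epigraph f) (WithLp.toLp 2 (x, (f x).toReal)) =
      regularNormalCone (epigraph f) (WithLp.toLp 2 (x, (f x).toReal))

/-- `f` is prox-regular at `a` for the subgradient `b`. -/
def IsProxRegularFor (f : E → EReal) (a b : E) : Prop :=
  f a < ⊤ ∧ ∃ ρ : ℝ, 0 ≤ ρ ∧ ∃ δ : ℝ, 0 < δ ∧ ∀ x x' v : E,
    ‖x - a‖ < δ → ‖x' - a‖ < δ →
    f a - (δ : EReal) < f x → f x < f a + (δ : EReal) →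
    v ∈ subdifferential f x → ‖v - b‖ < δ →
    f x + ((⟪v, x' - x⟫_ℝ - ρ / 2 * ‖x' - x‖ ^ 2 : ℝ) : EReal) ≤ f x'

/-- `f` is prox-regular at `a`: it is so for every subgradient `b ∈ ∂f(a)`. -/
def IsProxRegularAt (f : E → EReal) (a : E) : Prop :=
  f a < ⊤ ∧ ∀ b ∈ subdifferential f a, IsProxRegularFor f a b

/-- `M` is a `C²` manifold about `a ∈ M`: near `a` it is the solution set of finitely many `C²`
equations whose gradients at `a` are linearly independent. -/
def IsC2ManifoldAbout [CompleteSpace E] (M : Set E) (a : E) : Prop :=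
  a ∈ M ∧ ∃ (m : ℕ) (g : Fin m → E → ℝ) (U : Set E), IsOpen U ∧ a ∈ U ∧
    (∀ i, ContDiffOn ℝ 2 (g i) U) ∧
    LinearIndependent ℝ (fun i => gradient (g i) a) ∧
    M ∩ U = {x | x ∈ U ∧ ∀ i, g i x = 0}

/-- The tangent space of a manifold `M` at `x ∈ M`: the velocities at `x` of curves in `M`. -/
def tangentVectors (M : Set E) (x : E) : Set E :=
  {ξ | ∃ γ : ℝ → E, γ 0 = x ∧ (∀ᶠ t in 𝓝 (0 : ℝ), γ t ∈ M) ∧ HasDerivAt γ ξ 0}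

open Classical in
/-- The projection onto `M`: a nearest point of `M` to `z` (and `z` itself if there is none).
Near a point about which `M` is a `C²` manifold, the nearest point exists and is unique. -/
def proj (M : Set E) (z : E) : E :=
  if h : ∃ p ∈ M, ∀ q ∈ M, dist z p ≤ dist z q then h.choose else z

/-- `w` is the covariant derivative of `f` along `M` at `x`: it is tangent to `M` at `x`, and
`⟪w, ξ⟫` is the derivative of `t ↦ f (P_M (x + t ξ))` at `t = 0` for all tangent vectors `ξ`. -/
def IsCovariantGradient (M : Set E) (f : E → EReal) (x w : E) : Prop :=
  w ∈ tangentVectors M x ∧ ∀ ξ ∈ tangentVectors M x,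
    HasDerivAt (fun t : ℝ => (f (proj M (x + t • ξ))).toReal) ⟪w, ξ⟫_ℝ 0

open Classical in
/-- The covariant derivative `∇_M f(x)` (with the value `0` where it does not exist). -/
def covariantGradient (M : Set E) (f : E → EReal) (x : E) : E :=
  if h : ∃ w, IsCovariantGradient M f x w then h.choose else 0

/-- Continuity at `a`, relative to `M`, of a set-valued map `S` in the sense of
Painlevé-Kuratowski: inner semicontinuity and outer semicontinuity. -/
def SetValuedContinuousWithinAt (S : E → Set E) (M : Set E) (a : E) : Prop :=
  (∀ v ∈ S a, ∀ V ∈ 𝓝 v, ∀ᶠ x in 𝓝[M] a, (S x ∩ V).Nonempty) ∧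
  (∀ v, (∀ V ∈ 𝓝 v, ∃ᶠ x in 𝓝[M] a, (S x ∩ V).Nonempty) → v ∈ S a)

/-- `f` is `C²`-partly smooth at `a` relative to `M` (where `M` is a `C²` manifold about `a`). -/
structure IsC2PartlySmoothAt [CompleteSpace E] (f : E → EReal) (M : Set E) (a : E) : Prop where
  manifold : IsC2ManifoldAbout M a
  restricted_smoothness : ∃ (U : Set E) (g : E → ℝ), IsOpen U ∧ a ∈ U ∧ ContDiffOn ℝ 2 g U ∧
    ∀ x ∈ M ∩ U, f x = ((g x : ℝ) : EReal)
  regularity : ∀ᶠ x in 𝓝[M] a, IsRegularAt f x ∧ (subdifferential f x).Nonempty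
  normal_sharpness : ∃ b : E,
    (affineSpan ℝ (subdifferential f a) : Set E) = (fun u => b + u) '' normalCone M a
  subgradient_continuity : SetValuedContinuousWithinAt (subdifferential f) M a

/-- `f` has the Kurdyka-Łojasiewicz property at `a ∈ dom ∂f` with exponent `α`. The distance from
`0` to the empty set is `+∞`. -/
def HasKLExponentAt (f : E → EReal) (a : E) (α : ℝ) : Prop :=
  (subdifferential f a).Nonempty ∧
  ∃ (c ε : ℝ) (ν : EReal), 0 < c ∧ 0 < ε ∧ 0 < ν ∧
    ∀ x : E, ‖x - a‖ ≤ ε → f a < f x → f x < f a + ν →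
      ENNReal.ofReal (c * ((f x).toReal - (f a).toReal) ^ α) ≤
        Metric.infEDist 0 (subdifferential f x)

end

end VarAnalysis

/-! A subgradient `v` at a point `x` near `a`, with value slightly above `f a`, is either long or
short. A long one satisfies the inequality trivially, since `(f x - f a) ^ α ≤ 1`. A short one
forces `x ∈ M` (identification, `IsC2PartlySmoothAt.mem_of_small_subgradient`), and there the
covariant derivative is no longer than `v` (`IsCovariantGradient.norm_le`), so the inequality on `M`
transfers.

Identification is by contradiction. If points off `M` converge to `a` with values converging to `f
a` and subgradients tending to `0`, the unit vectors from their projections on `M` accumulate at a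
normal `n`. As `0 ∈ ri ∂f(a)`, some `ε • n` with `ε > 0` is a subgradient at `a`, and by inner
semicontinuity there are subgradients close to it at the projections. Adding the prox-regularity
inequalities at the point and at its projection bounds a quantity near `ε` by a multiple of their
vanishing distance. -/

namespace VarAnalysis

variable {E : Type*} [NormedAddCommGroup E] [InnerProductSpace ℝ E]

/-! ### Existence of nearest points. -/

/-- `M` is locally compact about `a` if it is a `C²` manifold about `a`. -/
theorem IsC2ManifoldAbout.exists_isCompact_inter_closedBall [CompleteSpace E] [ProperSpace E]
    {M : Set E} {a : E} (hM : IsC2ManifoldAbout M a) {V : Set E} (hV : V ∈ 𝓝 a) :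
    ∃ r : ℝ, 0 < r ∧ Metric.closedBall a r ⊆ V ∧ IsCompact (M ∩ Metric.closedBall a r) := by
  obtain ⟨-, m, g, U, hU, haU, hg, -, hMU⟩ := hM
  obtain ⟨r, hr, hrU⟩ :=
    Metric.nhds_basis_closedBall.mem_iff.1 (inter_mem hV (hU.mem_nhds haU))
  refine ⟨r, hr, fun x hx => (hrU hx).1, ?_⟩
  -- Ball membership is repeated inside each zero set because `g i` is only known to be continuous
  -- on `U`.
  have heq : M ∩ Metric.closedBall a r =
      Metric.closedBall a r ∩ ⋂ i, {x | x ∈ Metric.closedBall a r ∧ g i x = 0} := by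
    ext x
    simp only [mem_inter_iff, mem_iInter, mem_ofPred_eq]
    constructor
    · rintro ⟨hxM, hxr⟩
      have : x ∈ M ∩ U := ⟨hxM, (hrU hxr).2⟩
      rw [hMU] at this
      exact ⟨hxr, fun i => ⟨hxr, this.2 i⟩⟩
    · rintro ⟨hxr, hx⟩
      have : x ∈ M ∩ U := by rw [hMU]; exact ⟨(hrU hxr).2, fun i => (hx i).2⟩
      exact ⟨this.1, hxr⟩
  rw [heq]
  refine (isCompact_closedBall a r).inter_right (isClosed_iInter fun i => ?_)
  exact ((hg i).continuousOn.mono fun x hx => (hrU hx).2).preimage_isClosed_of_isClosed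
    Metric.isClosed_closedBall isClosed_singleton

omit [InnerProductSpace ℝ E] in
theorem proj_spec {M : Set E} {z : E} (h : ∃ p ∈ M, ∀ q ∈ M, dist z p ≤ dist z q) :
    proj M z ∈ M ∧ ∀ q ∈ M, dist z (proj M z) ≤ dist z q := by
  rw [proj, dif_pos h]
  exact h.choose_spec

-- A point of `M` outside the ball is farther than `r / 2` from `z`, so it cannot beat `a`;
-- minimizing over the compact piece suffices.
omit [InnerProductSpace ℝ E] in
theorem exists_nearest_of_isCompact {M : Set E} {a z : E} {r : ℝ} (ha : a ∈ M) (hr : 0 < r)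
    (hM : IsCompact (M ∩ Metric.closedBall a r)) (hz : dist z a ≤ r / 2) :
    ∃ p ∈ M, ∀ q ∈ M, dist z p ≤ dist z q := by
  obtain ⟨p, hp, hmin⟩ := hM.exists_isMinOn ⟨a, ha, Metric.mem_closedBall_self hr.le⟩
    (f := fun q => dist z q) (by fun_prop)
  refine ⟨p, hp.1, fun q hq => ?_⟩
  by_cases hqr : q ∈ Metric.closedBall a r
  · exact hmin ⟨hq, hqr⟩
  · have h1 : dist z p ≤ dist z a := hmin ⟨ha, Metric.mem_closedBall_self hr.le⟩
    have h2 := dist_triangle_left q a z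
    rw [Metric.mem_closedBall, not_le] at hqr
    linarith

/-! ### Normal vectors and the relative interior. -/

theorem zero_le_liminf_of_eventually {ι : Type*} {l : Filter ι} {u : ι → EReal}
    (h : ∀ ε : ℝ, 0 < ε → ∀ᶠ i in l, ((-ε : ℝ) : EReal) ≤ u i) : 0 ≤ liminf u l := by
  refine le_of_forall_lt fun c hc => ?_
  obtain ⟨d, hcd, hd⟩ := EReal.lt_iff_exists_real_btwn.1 hc
  have hd' : d < 0 := by exact_mod_cast hd
  refine hcd.trans_le (le_liminf_of_le (by isBoundedDefault) ?_)
  simpa using h (-d) (by linarith)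

/-- Expanding `‖z - p‖² ≤ ‖z - q‖²` gives `2⟪z - p, q - p⟫ ≤ ‖q - p‖²`, which is of second order in
`q - p`. -/
theorem smul_sub_mem_regularNormalCone {M : Set E} {z p : E} (hp : p ∈ M)
    (hmin : ∀ q ∈ M, dist z p ≤ dist z q) {s : ℝ} (hs : 0 ≤ s) :
    s • (z - p) ∈ regularNormalCone M p := by
  have hp0 : indicatorFun M p = 0 := by simp [indicatorFun, hp]
  refine ⟨by rw [hp0]; exact EReal.zero_lt_top, zero_le_liminf_of_eventually fun ε hε => ?_⟩
  have hball : ∀ᶠ q in 𝓝[≠] p, s * ‖q - p‖ < 2 * ε := by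
    have : Tendsto (fun q => s * ‖q - p‖) (𝓝[≠] p) (𝓝 (s * ‖p - p‖)) :=
      (Continuous.tendsto (by fun_prop) p).mono_left nhdsWithin_le_nhds
    exact this.eventually_lt_const (by simpa using hε)
  filter_upwards [hball, self_mem_nhdsWithin] with q hq hqp
  have hpos : 0 < ‖q - p‖ := norm_pos_iff.2 (sub_ne_zero.2 hqp)
  rw [hp0]
  by_cases hqM : q ∈ M
  · have hq0 : indicatorFun M q = 0 := by simp [indicatorFun, hqM]
    have hle : 2 * ⟪z - p, q - p⟫_ℝ ≤ ‖q - p‖ ^ 2 := by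
      have h1 := hmin q hqM
      rw [dist_eq_norm, dist_eq_norm] at h1
      have h2 : ‖z - q‖ ^ 2 = ‖z - p‖ ^ 2 - 2 * ⟪z - p, q - p⟫_ℝ + ‖q - p‖ ^ 2 := by
        rw [← norm_sub_sq_real]; congr 2; abel
      have h3 : ‖z - p‖ ^ 2 ≤ ‖z - q‖ ^ 2 := by gcongr
      linarith
    rw [hq0, sub_zero, zero_sub, ← EReal.coe_neg, ← EReal.coe_div, EReal.coe_le_coe_iff,
      le_div_iff₀ hpos, inner_smul_left]
    simp only [conj_trivial]
    nlinarith [mul_le_mul_of_nonneg_left hle hs, mul_lt_mul_of_pos_right hq hpos]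
  · have hq0 : indicatorFun M q = ⊤ := by simp [indicatorFun, hqM]
    rw [hq0, sub_zero, EReal.top_sub_coe, EReal.top_div_of_pos_ne_top (by exact_mod_cast hpos)
      (EReal.coe_ne_top _)]
    exact le_top

theorem zero_mem_normalCone {M : Set E} {a : E} (ha : a ∈ M) : (0 : E) ∈ normalCone M a := by
  have h0 : (0 : E) ∈ regularNormalCone M a := by
    simpa using smul_sub_mem_regularNormalCone (z := a) ha (by simp) (le_refl (0 : ℝ))
  exact ⟨h0.1, fun _ => a, fun _ => 0, tendsto_const_nhds, tendsto_const_nhds,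
    tendsto_const_nhds, fun _ => h0⟩

theorem mem_normalCone_of_tendsto {M : Set E} {a v : E} (ha : a ∈ M) {p w : ℕ → E}
    (hpM : ∀ k, p k ∈ M) (hp : Tendsto p atTop (𝓝 a)) (hw : Tendsto w atTop (𝓝 v))
    (hN : ∀ k, w k ∈ regularNormalCone M (p k)) : v ∈ normalCone M a := by
  refine ⟨by simp [indicatorFun, ha], p, w, hp, ?_, hw, hN⟩
  simp [indicatorFun, ha, hpM]

/-- If `0` lies in the relative interior of `S` and the affine span of `S` is a translate of a set
`N` containing `0`, then `S` contains small multiples of the elements of `N`. -/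
theorem exists_smul_mem_of_zero_mem_intrinsicInterior {S N : Set E} {b v : E}
    (hS : (0 : E) ∈ intrinsicInterior ℝ S)
    (hb : (affineSpan ℝ S : Set E) = (fun u => b + u) '' N) (hN : 0 ∈ N) (hv : v ∈ N) :
    ∃ ε : ℝ, 0 < ε ∧ ε • v ∈ S := by
  have h0 : (0 : E) ∈ affineSpan ℝ S := subset_affineSpan ℝ S (intrinsicInterior_subset hS)
  have hbS : b ∈ affineSpan ℝ S := by
    have : b ∈ (affineSpan ℝ S : Set E) := by rw [hb]; exact ⟨0, hN, by simp⟩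
    exact this
  have hbv : b + v ∈ affineSpan ℝ S := by
    have : b + v ∈ (affineSpan ℝ S : Set E) := by rw [hb]; exact ⟨v, hv, rfl⟩
    exact this
  -- Both `b` and `b + v` lie in the span, so `v` is one of its directions, and the line through `0`
  -- along `v` stays inside.
  have hline : ∀ t : ℝ, t • v ∈ affineSpan ℝ S := fun t => by
    simpa using (affineSpan ℝ S).smul_vsub_vadd_mem t hbv hbS h0
  obtain ⟨y, hy, hy0⟩ := mem_intrinsicInterior.1 hS
  have hy' : y = ⟨(0 : ℝ) • v, hline 0⟩ := Subtype.ext (by simpa using hy0)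
  have hcont : Continuous fun t : ℝ => (⟨t • v, hline t⟩ : affineSpan ℝ S) := by fun_prop
  rw [hy'] at hy
  have hev : ∀ᶠ t : ℝ in 𝓝 0, t • v ∈ S := by
    filter_upwards [hcont.continuousAt.preimage_mem_nhds (isOpen_interior.mem_nhds hy)] with t ht
    exact interior_subset (s := ((↑) : affineSpan ℝ S → E) ⁻¹' S) ht
  obtain ⟨t, ht, ht0⟩ := ((hev.filter_mono nhdsWithin_le_nhds).and
    (self_mem_nhdsWithin (s := Ioi (0 : ℝ)))).exists
  exact ⟨t, ht0, ht⟩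

/-! ### First-order behaviour of the projection; covariant derivative against subgradients. -/

omit [InnerProductSpace ℝ E] in
theorem tendsto_proj {M : Set E} {a : E} (ha : a ∈ M) {ι : Type*} {l : Filter ι} {x : ι → E}
    (hx : Tendsto x l (𝓝 a))
    (h : ∀ᶠ k in l, ∃ p ∈ M, ∀ q ∈ M, dist (x k) p ≤ dist (x k) q) :
    Tendsto (fun k => proj M (x k)) l (𝓝 a) := by
  -- Since `a` competes with the projection, the triangle inequality gives the factor `2`.
  have hxa : Tendsto (fun k => 2 * dist (x k) a) l (𝓝 0) := by
    simpa using (tendsto_iff_dist_tendsto_zero.1 hx).const_mul 2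
  refine tendsto_iff_dist_tendsto_zero.2 (squeeze_zero' (.of_forall fun _ => dist_nonneg) ?_ hxa)
  filter_upwards [h] with k hk
  linarith [(proj_spec hk).2 a ha, dist_triangle_left (proj M (x k)) a (x k)]

omit [InnerProductSpace ℝ E] in
theorem proj_eq_self {M : Set E} {x : E} (hx : x ∈ M) : proj M x = x := by
  have h := (proj_spec (M := M) (z := x) ⟨x, hx, by simp⟩).2 x hx
  rw [dist_self] at h
  exact (dist_le_zero.1 h).symm

/-- To first order the nearest-point projection does not move tangent displacements. -/
theorem hasDerivAt_proj_of_mem_tangentVectors {M : Set E} {x ξ : E} (hx : x ∈ M)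
    (hξ : ξ ∈ tangentVectors M x)
    (hnear : ∀ᶠ z in 𝓝 x, ∃ p ∈ M, ∀ q ∈ M, dist z p ≤ dist z q) :
    HasDerivAt (fun t : ℝ => proj M (x + t • ξ)) ξ 0 := by
  obtain ⟨γ, hγ0, hγM, hγ⟩ := hξ
  have hline : Tendsto (fun t : ℝ => x + t • ξ) (𝓝 0) (𝓝 x) := by
    have h : Continuous fun t : ℝ => x + t • ξ := by fun_prop
    simpa using h.tendsto 0
  rw [hasDerivAt_iff_isLittleO] at hγ ⊢
  -- The curve point `γ t ∈ M` competes with the projection of `x + t • ξ`, and it is already within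
  -- `o(t)` of that point.
  refine Asymptotics.IsBigO.trans_isLittleO (.of_bound 1 ?_) hγ
  filter_upwards [hγM, hline.eventually hnear] with t htM ht
  have h := (proj_spec ht).2 _ htM
  rw [dist_comm, dist_comm _ (γ t), dist_eq_norm, dist_eq_norm] at h
  simpa [proj_eq_self hx, hγ0, sub_sub] using h

/-- A proximal subgradient along `M` is at least as long as the covariant derivative. -/
theorem IsCovariantGradient.norm_le {M : Set E} {f : E → EReal} {x v w : E} {ρ : ℝ} (hx : x ∈ M)
    (hw : IsCovariantGradient M f x w)
    (hnear : ∀ᶠ z in 𝓝 x, ∃ p ∈ M, ∀ q ∈ M, dist z p ≤ dist z q)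
    (hv : ∀ᶠ y in 𝓝[M] x,
      (f x).toReal + (⟪v, y - x⟫_ℝ - ρ / 2 * ‖y - x‖ ^ 2) ≤ (f y).toReal) :
    ‖w‖ ≤ ‖v‖ := by
  obtain ⟨hwT, hder⟩ := hw
  have hp := hasDerivAt_proj_of_mem_tangentVectors hx hwT hnear
  have hp0 : proj M (x + (0 : ℝ) • w) = x := by simpa using proj_eq_self hx
  have hline : Tendsto (fun t : ℝ => x + t • w) (𝓝 0) (𝓝 x) := by
    have h : Continuous fun t : ℝ => x + t • w := by fun_prop
    simpa using h.tendsto 0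
  have hpx : Tendsto (fun t : ℝ => proj M (x + t • w)) (𝓝 0) (𝓝[M] x) := by
    refine tendsto_nhdsWithin_iff.2 ⟨?_, ?_⟩
    · have h := hp.continuousAt.tendsto
      rwa [hp0] at h
    · filter_upwards [hline.eventually hnear] with t ht using (proj_spec ht).1
  have hsub := hp.sub_const x
  have hinner := (hasDerivAt_const (0 : ℝ) v).inner ℝ hsub
  have hsq := hsub.norm_sq
  have hh := ((hder w hwT).sub hinner).add (hsq.const_mul (ρ / 2))
  -- The proximal inequality makes `t = 0` a local minimum along the projected line. The quadratic
  -- term has zero derivative there, so `⟪w, w⟫ = ⟪v, w⟫`, and Cauchy-Schwarz concludes.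
  have hmin : IsLocalMin ((fun t : ℝ => (f (proj M (x + t • w))).toReal) -
      (fun t : ℝ => ⟪v, proj M (x + t • w) - x⟫_ℝ) +
      fun t : ℝ => ρ / 2 * ‖proj M (x + t • w) - x‖ ^ 2) 0 := by
    filter_upwards [hpx.eventually hv] with t ht
    simp only [Pi.add_apply, Pi.sub_apply, hp0, sub_self, inner_zero_right, norm_zero]
    linarith
  have h0 := hmin.hasDerivAt_eq_zero hh
  simp only [hp0, sub_self, inner_zero_left, add_zero, mul_zero] at h0
  have hle := real_inner_le_norm v w
  rw [real_inner_self_eq_norm_sq] at h0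
  rcases (norm_nonneg w).eq_or_lt with hw0 | hw0
  · rw [← hw0]; exact norm_nonneg v
  · nlinarith

/-! ### Identification of the active manifold. -/

theorem IsProxRegularFor.exists_real {f : E → EReal} {a b : E} {r₀ : ℝ} (ha : f a = r₀)
    (h : IsProxRegularFor f a b) :
    ∃ ρ δ : ℝ, 0 ≤ ρ ∧ 0 < δ ∧ ∀ (x x' v : E) (r r' : ℝ), f x = r → f x' = r' →
      ‖x - a‖ < δ → ‖x' - a‖ < δ → |r - r₀| < δ → v ∈ subdifferential f x → ‖v - b‖ < δ →
      r + (⟪v, x' - x⟫_ℝ - ρ / 2 * ‖x' - x‖ ^ 2) ≤ r' := by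
  obtain ⟨-, ρ, hρ, δ, hδ, h⟩ := h
  refine ⟨ρ, δ, hρ, hδ, fun x x' v r r' hr hr' hx hx' hrr hv hvb => ?_⟩
  have hrr := abs_lt.1 hrr
  have := h x x' v hx hx' (by rw [ha, hr]; exact_mod_cast (by linarith : r₀ - δ < r))
    (by rw [ha, hr]; exact_mod_cast (by linarith : r < r₀ + δ)) hv hvb
  rw [hr, hr'] at this
  exact_mod_cast this

/-- Identification: points near `a` with function value near `f a` and a small subgradient lie on
the active manifold. -/
theorem IsC2PartlySmoothAt.mem_of_small_subgradient [CompleteSpace E] [ProperSpace E]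
    {f : E → EReal} {M : Set E} {a : E} {r₀ : ℝ} (hM : IsC2PartlySmoothAt f M a)
    (hprox : IsProxRegularAt f a) (hri : (0 : E) ∈ intrinsicInterior ℝ (subdifferential f a))
    (ha : f a = r₀) :
    ∃ η : ℝ, 0 < η ∧ ∀ (x v : E) (r : ℝ), f x = r → ‖x - a‖ < η → |r - r₀| < η →
      v ∈ subdifferential f x → ‖v‖ < η → x ∈ M := by
  have haM : a ∈ M := hM.manifold.1
  obtain ⟨U, g, hU, haU, hg, hfg⟩ := hM.restricted_smoothness
  have hga : g a = r₀ := by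
    have := hfg a ⟨haM, haU⟩
    rw [ha] at this
    exact_mod_cast this.symm
  obtain ⟨R, hR, -, hcomp⟩ := hM.manifold.exists_isCompact_inter_closedBall univ_mem
  by_contra! hcon
  -- The factor `R / 2` keeps every `x k` where a nearest point of `M` exists.
  have hη : ∀ k : ℕ, 0 < R / 2 * (1 / ((k : ℝ) + 1)) := fun k => by positivity
  have hη0 : Tendsto (fun k : ℕ => R / 2 * (1 / ((k : ℝ) + 1))) atTop (𝓝 0) := by
    simpa using (tendsto_one_div_add_atTop_nhds_zero_nat (𝕜 := ℝ)).const_mul (R / 2)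
  choose x v r hfx hxa hr hv hv0 hxM using fun k : ℕ => hcon _ (hη k)
  have hx : Tendsto x atTop (𝓝 a) :=
    tendsto_iff_norm_sub_tendsto_zero.2
      (squeeze_zero (fun _ => norm_nonneg _) (fun k => (hxa k).le) hη0)
  have hnear : ∀ k, ∃ p ∈ M, ∀ q ∈ M, dist (x k) p ≤ dist (x k) q := fun k => by
    refine exists_nearest_of_isCompact haM hR hcomp ?_
    rw [dist_eq_norm]
    refine (hxa k).le.trans (mul_le_of_le_one_right (by positivity) ?_)
    rw [div_le_one (by positivity)]
    linarith [(Nat.cast_nonneg k : (0 : ℝ) ≤ k)]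
  have hp : Tendsto (fun k => proj M (x k)) atTop (𝓝 a) := tendsto_proj haM hx (.of_forall hnear)
  set p : ℕ → E := fun k => proj M (x k) with hpdef
  have hpM : ∀ k, p k ∈ M := fun k => (proj_spec (hnear k)).1
  have hpos : ∀ k, 0 < ‖x k - p k‖ := fun k =>
    norm_pos_iff.2 (sub_ne_zero.2 fun h => hxM k (h ▸ hpM k))
  set u : ℕ → E := fun k => ‖x k - p k‖⁻¹ • (x k - p k) with hudef
  have hu1 : ∀ k, u k ∈ Metric.sphere (0 : E) 1 := fun k => by
    simp [hudef, norm_smul, (hpos k).ne']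
  obtain ⟨n, hn1, φ, hφ, hun⟩ := (isCompact_sphere (0 : E) 1).tendsto_subseq hu1
  have hn1 : ‖n‖ = 1 := by simpa using hn1
  have hφt := hφ.tendsto_atTop
  have hnN : n ∈ normalCone M a :=
    mem_normalCone_of_tendsto haM (fun k => hpM (φ k)) (hp.comp hφt) hun fun k =>
      smul_sub_mem_regularNormalCone (hpM _) (proj_spec (hnear _)).2
        (inv_nonneg.2 (hpos _).le)
  obtain ⟨b, hb⟩ := hM.normal_sharpness
  -- Prox-regularity is used for two subgradients at `a`: for `0`, close to the `v k`, and for `ε •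
  -- n`, close to the subgradients at the projections.
  obtain ⟨ε, hε, hεn⟩ :=
    exists_smul_mem_of_zero_mem_intrinsicInterior hri hb (zero_mem_normalCone haM) hnN
  obtain ⟨ρ₁, δ₁, hρ₁, hδ₁, h₁⟩ :=
    (hprox.2 0 (intrinsicInterior_subset hri)).exists_real ha
  obtain ⟨ρ₂, δ₂, hρ₂, hδ₂, h₂⟩ := (hprox.2 _ hεn).exists_real ha
  have hsub := hM.subgradient_continuity.1 _ hεn _
    (Metric.ball_mem_nhds _ (lt_min hδ₂ (show 0 < ε / 4 by positivity)))
  have hpin : Tendsto (p ∘ φ) atTop (𝓝[M] a) :=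
    tendsto_nhdsWithin_iff.2 ⟨hp.comp hφt, .of_forall fun k => hpM _⟩
  have hdiff : Tendsto (fun k => (ρ₁ + ρ₂) / 2 * ‖x (φ k) - p (φ k)‖) atTop (𝓝 0) := by
    simpa using (((hx.sub hp).norm).comp hφt).const_mul ((ρ₁ + ρ₂) / 2)
  have hinner : Tendsto (fun k => ⟪n, u (φ k)⟫_ℝ) atTop (𝓝 1) := by
    have h : Tendsto (fun k => ⟪n, u (φ k)⟫_ℝ) atTop (𝓝 ⟪n, n⟫_ℝ) := tendsto_const_nhds.inner hun
    rwa [real_inner_self_eq_norm_sq, hn1, one_pow] at h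
  have hgp : Tendsto (fun k => |g (p (φ k)) - r₀|) atTop (𝓝 0) := by
    have h := ((hg.continuousOn.continuousAt (hU.mem_nhds haU)).tendsto.comp
      (hp.comp hφt)).sub_const r₀
    simpa [hga] using h.abs
  have hxφ := tendsto_iff_norm_sub_tendsto_zero.1 (hx.comp hφt)
  have hpφ := tendsto_iff_norm_sub_tendsto_zero.1 (hp.comp hφt)
  have hηφ := hη0.comp hφt
  -- The tolerances make `⟪y, u⟫ - ⟪v, u⟫ > 3ε/4 - ε/4 - ε/4 = ε/4`, while the quadratic error per
  -- unit of distance is below `ε/4`.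
  obtain ⟨k, ⟨y, hy, hyV⟩, hk1, hk2, hk3, hk4, hk5, hk6, hk7⟩ :=
    ((hpin.eventually hsub).and <|
      (hdiff.eventually_lt_const (show 0 < ε / 4 by positivity)).and <|
      (hinner.eventually_const_lt (show (3 / 4 : ℝ) < 1 by norm_num)).and <|
      (hgp.eventually_lt_const hδ₂).and <|
      (hxφ.eventually_lt_const (lt_min hδ₁ hδ₂)).and <|
      (hpφ.eventually_lt_const (lt_min hδ₁ hδ₂)).and <|
      (hηφ.eventually_lt_const (lt_min hδ₁ (show 0 < ε / 4 by positivity))).and <|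
      (hp.comp hφt).eventually (hU.mem_nhds haU)).exists
  simp only [Function.comp_apply, lt_min_iff, mem_ball_iff_norm] at hyV hk4 hk5 hk6 hk7 hy
  have hfp := hfg _ ⟨hpM (φ k), hk7⟩
  have e₁ := h₁ _ _ _ _ _ (hfx (φ k)) hfp hk4.1 hk5.1 ((hr _).trans hk6.1) (hv _)
    (by rw [sub_zero]; exact (hv0 _).trans hk6.1)
  have e₂ := h₂ _ _ _ _ _ hfp (hfx (φ k)) hk5.2 hk4.2 hk3 hy hyV.1
  have hdx : x (φ k) - p (φ k) = ‖x (φ k) - p (φ k)‖ • u (φ k) := by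
    simp [hudef, smul_smul, (hpos (φ k)).ne']
  have hnu : ‖u (φ k)‖ = 1 := by simpa using hu1 (φ k)
  rw [← neg_sub (x (φ k)) (p (φ k)), inner_neg_right, norm_neg] at e₁
  have f₁ : ⟪v (φ k), x (φ k) - p (φ k)⟫_ℝ = ‖x (φ k) - p (φ k)‖ * ⟪v (φ k), u (φ k)⟫_ℝ := by
    conv_lhs => rw [hdx, inner_smul_right]
  have f₂ : ⟪y, x (φ k) - p (φ k)⟫_ℝ = ‖x (φ k) - p (φ k)‖ * ⟪y, u (φ k)⟫_ℝ := by
    conv_lhs => rw [hdx, inner_smul_right]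
  rw [f₁] at e₁
  rw [f₂] at e₂
  have g₁ : ⟪v (φ k), u (φ k)⟫_ℝ < ε / 4 := by
    have := real_inner_le_norm (v (φ k)) (u (φ k))
    rw [hnu, mul_one] at this
    exact this.trans_lt ((hv0 _).trans hk6.2)
  have g₂ : ε * (3 / 4) - ε / 4 < ⟪y, u (φ k)⟫_ℝ := by
    have h := real_inner_le_norm (ε • n - y) (u (φ k))
    rw [hnu, mul_one, inner_sub_left, inner_smul_left, norm_sub_rev] at h
    simp only [conj_trivial] at h
    have := mul_lt_mul_of_pos_left hk2 hε
    linarith [hyV.2]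
  have hd := hpos (φ k)
  -- In the sum of `e₁` and `e₂` the function values cancel.
  have hfinal : ‖x (φ k) - p (φ k)‖ * (⟪y, u (φ k)⟫_ℝ - ⟪v (φ k), u (φ k)⟫_ℝ -
      (ρ₁ + ρ₂) / 2 * ‖x (φ k) - p (φ k)‖) ≤ 0 := by
    linarith
  have := nonpos_of_mul_nonpos_right hfinal hd
  linarith

/-! ### The Kurdyka-Łojasiewicz inequality. -/

/-- Under partial smoothness, prox-regularity and `0 ∈ ri ∂f(a)`, a Łojasiewicz inequality for the
covariant derivative on the active manifold gives the Kurdyka-Łojasiewicz property. -/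
theorem IsC2PartlySmoothAt.hasKLExponentAt [CompleteSpace E] [ProperSpace E]
    {f : E → EReal} {M : Set E} {a : E} (hM : IsC2PartlySmoothAt f M a)
    (hprox : IsProxRegularAt f a) (hri : (0 : E) ∈ intrinsicInterior ℝ (subdifferential f a))
    {α c ν ε : ℝ} (hα : 0 ≤ α) (hc : 0 < c) (hν : 0 < ν) (hε : 0 < ε)
    (hKL : ∀ x ∈ M, ‖x - a‖ ≤ ε → f a < f x → f x < f a + (ν : EReal) →
      c * ((f x).toReal - (f a).toReal) ^ α ≤ ‖covariantGradient M f x‖) :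
    HasKLExponentAt f a α := by
  have haM : a ∈ M := hM.manifold.1
  have h0 := intrinsicInterior_subset hri
  obtain ⟨U, g, hU, haU, -, hfg⟩ := hM.restricted_smoothness
  have ha : f a = (g a : ℝ) := hfg a ⟨haM, haU⟩
  obtain ⟨R, hR, hRU, hcomp⟩ := hM.manifold.exists_isCompact_inter_closedBall (hU.mem_nhds haU)
  obtain ⟨η, hη, hid⟩ := hM.mem_of_small_subgradient hprox hri ha
  obtain ⟨ρ, δ, -, hδ, hprox₀⟩ := (hprox.2 0 h0).exists_real ha
  -- `η` serves identification, `δ` prox-regularity, `R / 2` nearest points, `ε` and `ν` the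
  -- inequality on `M`; the bound `1` keeps the power at most `1`.
  obtain ⟨κ, hκ, hκη, hκδ, hκR, hκε, hκν, hκ1⟩ : ∃ κ : ℝ, 0 < κ ∧ κ ≤ η ∧ κ ≤ δ ∧ κ ≤ R / 2 ∧
      κ ≤ ε ∧ κ ≤ ν ∧ κ ≤ 1 := by
    refine ⟨min η (min δ (min (R / 2) (min ε (min ν 1)))), by positivity, ?_⟩
    simp
  refine ⟨⟨0, h0⟩, min c κ, κ / 2, (κ : EReal), by positivity, by positivity,
    by exact_mod_cast hκ, fun x hx hlo hhi => Metric.le_infEDist.2 fun v hv => ?_⟩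
  obtain ⟨r, hr⟩ : ∃ r : ℝ, f x = r := by
    have htop : f x ≠ ⊤ := hhi.ne_top
    exact ⟨(f x).toReal, (EReal.coe_toReal htop (bot_le.trans_lt hlo).ne').symm⟩
  have hlo' : g a < r := by rw [ha, hr] at hlo; exact_mod_cast hlo
  have hhi' : r < g a + κ := by rw [ha, hr] at hhi; exact_mod_cast hhi
  have habs : |r - g a| < κ := abs_lt.2 ⟨by linarith, by linarith⟩
  have hxκ : ‖x - a‖ < κ := by linarith
  rw [edist_comm, edist_dist, dist_zero_right]
  refine ENNReal.ofReal_le_ofReal ?_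
  have hs0 : 0 < ((f x).toReal - (f a).toReal) ^ α := by
    rw [hr, ha]; exact Real.rpow_pos_of_pos (by simpa using hlo') _
  have hs1 : ((f x).toReal - (f a).toReal) ^ α ≤ 1 := by
    rw [hr, ha]
    exact Real.rpow_le_one (by simpa using hlo'.le) (by simp only [EReal.toReal_coe]; linarith) hα
  -- Long subgradients need nothing but the constant `κ`; only short ones require `M`.
  rcases le_or_gt κ ‖v‖ with hvκ | hvκ
  · calc min c κ * ((f x).toReal - (f a).toReal) ^ α ≤ κ * 1 := by
          gcongr; exact min_le_right _ _
      _ ≤ ‖v‖ := by linarith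
  have hxM : x ∈ M := hid x v r hr (by linarith) (by linarith) hv (by linarith)
  have hcov := hKL x hxM (by linarith) hlo (by
    rw [hr, ha]; exact_mod_cast (by linarith : r < g a + ν))
  have hpos := mul_pos hc hs0
  -- The default value `0` of `covariantGradient` would contradict the positive lower bound, so the
  -- derivative exists.
  have hex : ∃ w, IsCovariantGradient M f x w := by
    by_contra hne
    rw [covariantGradient, dif_neg hne, norm_zero] at hcov
    linarith
  rw [covariantGradient, dif_pos hex] at hcov
  have hle : ‖hex.choose‖ ≤ ‖v‖ := by
    refine hex.choose_spec.norm_le (ρ := ρ) hxM ?_ ?_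
    · have hxR : x ∈ Metric.ball a (R / 2) := by rw [mem_ball_iff_norm]; linarith
      filter_upwards [Metric.isOpen_ball.mem_nhds hxR] with z hz
      exact exists_nearest_of_isCompact haM hR hcomp (Metric.mem_ball.1 hz).le
    · have hxκ' : x ∈ Metric.ball a κ := by rwa [mem_ball_iff_norm]
      filter_upwards [self_mem_nhdsWithin,
        nhdsWithin_le_nhds (Metric.isOpen_ball.mem_nhds hxκ')] with y hyM hy
      have hyκ := mem_ball_iff_norm.1 hy
      have hyU : y ∈ U := hRU (Metric.mem_closedBall.2 (by rw [dist_eq_norm]; linarith))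
      have hfy := hfg y ⟨hyM, hyU⟩
      rw [hr, hfy]
      exact hprox₀ x y v r (g y) hr hfy (by linarith) (by linarith) (by linarith) hv
        (by rw [sub_zero]; linarith)
  calc min c κ * ((f x).toReal - (f a).toReal) ^ α
      ≤ c * ((f x).toReal - (f a).toReal) ^ α := by gcongr; exact min_le_left _ _
    _ ≤ ‖v‖ := hcov.trans hle

end VarAnalysis

theorem mainTheorem10 (n : ℕ) (f : EuclideanSpace ℝ (Fin n) → EReal)
    (xbar : EuclideanSpace ℝ (Fin n)) (M : Set (EuclideanSpace ℝ (Fin n)))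
    (hproper : VarAnalysis.IsProper f) (hclosed : LowerSemicontinuous f)
    (hprox : VarAnalysis.IsProxRegularAt f xbar)
    (hsmooth : VarAnalysis.IsC2PartlySmoothAt f M xbar)
    (hri : (0 : EuclideanSpace ℝ (Fin n)) ∈
      intrinsicInterior ℝ (VarAnalysis.subdifferential f xbar))
    (α : ℝ) (hα0 : 0 ≤ α) (hα1 : α < 1)
    (hKL : ∃ c ν ε : ℝ, 0 < c ∧ 0 < ν ∧ 0 < ε ∧
      ∀ x ∈ M, ‖x - xbar‖ ≤ ε → f xbar < f x → f x < f xbar + (ν : EReal) →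
        c * ((f x).toReal - (f xbar).toReal) ^ α ≤ ‖VarAnalysis.covariantGradient M f x‖) :
    VarAnalysis.HasKLExponentAt f xbar α := by
  obtain ⟨c, ν, ε, hc, hν, hε, h⟩ := hKL
  exact hsmooth.hasKLExponentAt hprox hri hα0 hc hν hε h
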